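/- Let $\mathscr Q$ be a non-singular quadric in $\mathrm{PG}(n,2)$ of projective index $g\ge 1$ (the largest dimension of a subspace contained in $\mathscr Q$). Its point-graph $\Gamma$ has as vertices the points of $\mathscr Q$, two distinct points being adjacent when they lie on a line contained in $\mathscr Q$. For $0\le s<g$ choose an $s$-dimensional subspace $\alpha_s$ contained in $\mathscr Q$, and let $\mathcal X_s$ be the set of points of $\mathscr Q\setminus\alpha_s$ that lie in some $(s+1)$-dimensional subspace $\Pi$ with $\alpha_s\subset\Pi\subset\mathscr Q$. Let $\Gamma_s$ be the graph obtained from $\Gamma$ by the Godsil–McKay construction with respect to $\mathcal X_s$: for each point $R\in\mathscr Q\setminus\mathcal X_s$ that is adjacent in $\Gamma$ to exactly $\frac12|\mathcal X_s|$ vertices of $\mathcal X_s$, delete these edges and join $R$ to the other $\frac12|\mathcal X_s|$ vertices of $\mathcal X_s$; all other adjacencies are kept. Then, for every choice of the subspaces $\alpha_s$, the graphs $\Gamma_0,\Gamma_1,\dots,\Gamma_{g-1}$ are pairwise non-isomorphic. -/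

import Mathlib

open scoped LinearAlgebra.Projectivization

/-- The projective space `PG(n, q)`, over a field `K` with `q` elements. -/
abbrev PG (K : Type*) [Field K] (n : ℕ) : Type _ := ℙ K (Fin (n + 1) → K)

namespace PG

section Geometry

variable {K : Type*} [Field K] {n : ℕ}

/-- `T.HasDim d` (for `d ≥ 0`): the subspace `T` of `PG(n, q)` has projective dimension `d`, that is,
the corresponding vector subspace has dimension `d + 1`. The empty subspace has no such `d`. -/
def HasDim (T : Projectivization.Subspace K (Fin (n + 1) → K)) (d : ℕ) : Prop :=
  Module.finrank K (Projectivization.Subspace.submodule T) = d + 1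

/-- The quadric of `PG(n, q)` with equation `f = 0`. -/
def quadric (f : QuadraticForm K (Fin (n + 1) → K)) : Set (PG K n) :=
  {P | f P.rep = 0}

/-- Membership in a quadric may be tested on any representative vector. -/
theorem mk_mem_quadric_iff (f : QuadraticForm K (Fin (n + 1) → K)) (v : Fin (n + 1) → K)
    (hv : v ≠ 0) : Projectivization.mk K v hv ∈ quadric f ↔ f v = 0 := by
  obtain ⟨a, ha⟩ := Projectivization.exists_smul_eq_mk_rep K v hv
  have hf : f (Projectivization.mk K v hv).rep = (a : K) * (a : K) * f v := by
    rw [← ha, Units.smul_def, QuadraticMap.map_smul, smul_eq_mul]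
  simp [quadric, hf]

/-- A non-singular quadric: the zero set of a quadratic form `f` such that `f` vanishes at no nonzero
vector of the radical of its polar form, and that radical has dimension at most one. -/
def IsNonsingularQuadric (𝒬 : Set (PG K n)) : Prop :=
  ∃ f : QuadraticForm K (Fin (n + 1) → K), f.Nondegenerate ∧ 𝒬 = quadric f

/-- `g ≥ 0` is the projective index of `𝒬`: the largest dimension of a subspace contained in `𝒬`. -/
def IsProjectiveIndex (𝒬 : Set (PG K n)) (g : ℕ) : Prop :=
  IsGreatest {d : ℕ | ∃ T : Projectivization.Subspace K (Fin (n + 1) → K),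
    HasDim T d ∧ (T : Set (PG K n)) ⊆ 𝒬} g

/-- The point-graph of `𝒬`: the vertices are the points of `𝒬`, and two distinct vertices are
adjacent when they lie on a line contained in `𝒬`. -/
def pointGraph (𝒬 : Set (PG K n)) : SimpleGraph 𝒬 where
  Adj P R := P ≠ R ∧ ∃ ℓ : Projectivization.Subspace K (Fin (n + 1) → K),
    HasDim ℓ 1 ∧ (ℓ : Set (PG K n)) ⊆ 𝒬 ∧ (P : PG K n) ∈ ℓ ∧ (R : PG K n) ∈ ℓ
  symm := ⟨fun _ _ ⟨hne, ℓ, hd, hs, hP, hR⟩ => ⟨hne.symm, ℓ, hd, hs, hR, hP⟩⟩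
  loopless := ⟨fun _ h => h.1 rfl⟩

/-- The points of type (ii) with respect to an `s`-space `α` contained in `𝒬`: the points of `𝒬`
outside `α` that lie in some `(s + 1)`-space `S` with `α ⊆ S ⊆ 𝒬`. -/
def typeTwo (𝒬 : Set (PG K n)) (s : ℕ) (α : Projectivization.Subspace K (Fin (n + 1) → K)) :
    Set 𝒬 :=
  {P | (P : PG K n) ∉ α ∧ ∃ S : Projectivization.Subspace K (Fin (n + 1) → K),
    HasDim S (s + 1) ∧ α ≤ S ∧ (S : Set (PG K n)) ⊆ 𝒬 ∧ (P : PG K n) ∈ S}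

end Geometry

section Switching

variable {V : Type*}

/-- The vertex `R` lies outside `X` and is adjacent to exactly half of the vertices of `X`. -/
def IsHalfJoined (G : SimpleGraph V) (X : Set V) (R : V) : Prop :=
  R ∉ X ∧ 2 * (G.neighborSet R ∩ X).ncard = X.ncard

/-- The Godsil–McKay construction, for the partition of the vertices of a finite graph into `X` and
its complement: adjacency is reversed between each vertex of `X` and each vertex outside `X` that is
adjacent to exactly half of `X`, and is kept for all other pairs of vertices. -/
def godsilMcKay (G : SimpleGraph V) (X : Set V) : SimpleGraph V where
  Adj u v := Xor (G.Adj u v) ((IsHalfJoined G X u ∧ v ∈ X) ∨ (IsHalfJoined G X v ∧ u ∈ X))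
  symm := ⟨fun u v h => by rwa [G.adj_comm v u, or_comm]⟩
  loopless := ⟨fun u h => by
    have h1 : ¬ (IsHalfJoined G X u ∧ u ∈ X) := fun h => h.1.1 h.2
    simp [Xor, h1] at h⟩

end Switching

/-- The graph `Γ_s` obtained from the point-graph of `𝒬` by the Godsil–McKay construction, where `X`
is the set of points of type (ii) with respect to the `s`-space `α` contained in `𝒬`. -/
def graphGamma {K : Type*} [Field K] {n : ℕ} (𝒬 : Set (PG K n)) (s : ℕ)
    (α : Projectivization.Subspace K (Fin (n + 1) → K)) : SimpleGraph 𝒬 :=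
  godsilMcKay (pointGraph 𝒬) (typeTwo 𝒬 s α)

end PG

/-!
Let `f` be the quadratic form of the quadric, `W` the vector subspace of `α`, and `W^⊥ = perp f W` its
orthogonal space for the polar form. The points of `𝒬` fall into three classes: those of `W`, those of
type (ii), which are the singular vectors of `W^⊥` outside `W`, and those off `W^⊥`. As `s < g`, there
are points of type (ii) (`exists_singular_perp_not_mem`), and the vertices joined to exactly half of them
are exactly the points off `W^⊥` (`isHalfJoined_iff`). Hence for distinct points non-adjacency in `Γ_s`
is given over `𝔽₂` by the symmetric function (`nonAdj_graphGamma`)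

  `T(x, y) = polar f x y + X x * D y + X y * D x`,

with `X` the indicator of type (ii) and `D` the indicator of the complement of `W^⊥`.

A vertex `x` has *third vertices* if each neighbour `y` of `x` admits a vertex `z` for which the rows
of `x`, `y`, `z` in the matrix `T` have sum zero. Graph isomorphisms preserve this property. The
points of `W` have it, with `z = x + y` (`hasThirdVertices_of_mem`). If `s ≥ 1`, no other point has it
(`mem_of_hasThirdVertices`). Indeed, each point off `W^⊥` has a neighbour of type (ii), and each point
of type (ii) has a neighbour off `W^⊥`. If the rows of such a pair and of a third point `z` had sum
zero, then `polar f p u + ε * D u + δ * X u = 0` for all singular `u`, where `p` is the sum of the three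
vectors and `ε`, `δ` are the parities of the numbers of points of type (ii) and of points off `W^⊥` among
them. This forces `ε = δ = 0` (`parities_eq_zero`): the functional `polar f p` is constantly `ε` off
`W^⊥`, and as `W^⊥` has codimension at least two, there are two vectors which together with their sum
are off `W^⊥`. So `z` would have to be both of type (ii) and off `W^⊥`, which is absurd.

Thus for `s ≥ 1` the graph `Γ_s` has exactly `2 ^ (s + 1) - 1` vertices with third vertices. For
`s = 0`, say `W = {0, e}`, the involution which adds `e` to the vectors of type (ii) carries `T` to the
polar form, so that all vertices have third vertices (`exists_third_of_finrank_eq_one`).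
Hence `Γ_s` and `Γ_t` are not isomorphic for `s < t`: for `s ≥ 1` the numbers of these vertices differ, and
for `s = 0` the points of type (ii) of `Γ_t` lack third vertices.
-/

open QuadraticMap Module

namespace PG

/-! ### Orthogonality to a totally singular subspace over `𝔽₂` -/

section Vectors
variable {V : Type*} [AddCommGroup V] [Module (ZMod 2) V]

theorem zmod_two_eq_one_of_ne_zero : ∀ {a : ZMod 2}, a ≠ 0 → a = 1 := by decide

theorem exists_polar_eq_one {f : QuadraticForm (ZMod 2) V} (hf : f.Nondegenerate) {v : V}
    (hv : v ≠ 0) (hfv : f v = 0) : ∃ u, polar f v u = 1 := by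
  by_contra! h
  refine hv ?_
  have hr : v ∈ f.radical := by
    refine ⟨hfv, LinearMap.ext fun u => ?_⟩
    by_contra hu
    exact h u (zmod_two_eq_one_of_ne_zero hu)
  rwa [hf.radical_eq_bot, Submodule.mem_bot] at hr

/-- A totally singular subspace `W` whose dimension is less than that of another one, `U`, is not
maximal: the functionals `polar f u` on `W`, for `u ∈ U`, annihilate `U ∩ W`, so by a dimension count
some `u ∈ U` outside `W` is orthogonal to `W`. -/
theorem exists_singular_perp_not_mem [FiniteDimensional (ZMod 2) V]
    {f : QuadraticForm (ZMod 2) V} {W U : Submodule (ZMod 2) V} (hU : ∀ u ∈ U, f u = 0)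
    (hlt : finrank (ZMod 2) W < finrank (ZMod 2) U) :
    ∃ u, f u = 0 ∧ (∀ w ∈ W, polar f u w = 0) ∧ u ∉ W := by
  let φ : U →ₗ[ZMod 2] Dual (ZMod 2) W :=
    (W.subtype.dualMap).comp (f.polarBilin.comp U.subtype)
  have hφ : ∀ (u : U) (w : W), φ u w = polar f u w := fun _ _ => rfl
  have hrange : LinearMap.range φ ≤ (U.comap W.subtype).dualAnnihilator := by
    rintro _ ⟨u, rfl⟩
    rw [Submodule.mem_dualAnnihilator]
    intro w hw
    have hw' : (w : V) ∈ U := hw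
    simp [hφ, polar, hU _ (U.add_mem u.2 hw'), hU _ u.2, hU _ hw']
  by_contra! h
  have hker : finrank (ZMod 2) (LinearMap.ker φ) ≤ finrank (ZMod 2) (U.comap W.subtype) := by
    rw [← Submodule.finrank_map_subtype_eq U, ← Submodule.finrank_map_subtype_eq W]
    refine Submodule.finrank_mono ?_
    rintro _ ⟨u, hu, rfl⟩
    have hW : (u : V) ∈ W := h u (hU _ u.2) fun w hw => by
      rw [← hφ u ⟨w, hw⟩, LinearMap.mem_ker.1 hu]; rfl
    exact ⟨⟨u, hW⟩, u.2, rfl⟩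
  have h1 := LinearMap.finrank_range_add_finrank_ker φ
  have h2 := Submodule.finrank_mono hrange
  have h3 := Subspace.finrank_add_finrank_dualAnnihilator_eq (U.comap W.subtype)
  omega

/-- The subspace of vectors orthogonal to `W` for the polar form of `f`. -/
def perp (f : QuadraticForm (ZMod 2) V) (W : Submodule (ZMod 2) V) : Submodule (ZMod 2) V :=
  W.orthogonalBilin f.polarBilin

theorem mem_perp {f : QuadraticForm (ZMod 2) V} {W : Submodule (ZMod 2) V} {v : V} :
    v ∈ perp f W ↔ ∀ w ∈ W, polar f v w = 0 := by
  simp [perp, Submodule.mem_orthogonalBilin_iff, polar_comm f v]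

theorem not_mem_perp {f : QuadraticForm (ZMod 2) V} {W : Submodule (ZMod 2) V} {v : V} :
    v ∉ perp f W ↔ ∃ w ∈ W, polar f v w = 1 := by
  rw [mem_perp]
  push Not
  exact exists_congr fun w => and_congr_right fun _ =>
    ⟨zmod_two_eq_one_of_ne_zero, fun h => by rw [h]; exact one_ne_zero⟩

theorem polar_eq_zero_of_mem {f : QuadraticForm (ZMod 2) V} {W : Submodule (ZMod 2) V}
    (hW : ∀ w ∈ W, f w = 0) {v w : V} (hv : v ∈ W) (hw : w ∈ W) : polar f v w = 0 := by
  simp [polar, hW _ (W.add_mem hv hw), hW _ hv, hW _ hw]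

theorem le_perp {f : QuadraticForm (ZMod 2) V} {W : Submodule (ZMod 2) V}
    (hW : ∀ w ∈ W, f w = 0) : W ≤ perp f W :=
  fun _ hv => mem_perp.2 fun _ hw => polar_eq_zero_of_mem hW hv hw

open Classical in
/-- The indicator function, with values in `𝔽₂`, of the vectors of type (ii): the singular vectors
orthogonal to `W` and not in `W`. -/
noncomputable def typeTwoInd (f : QuadraticForm (ZMod 2) V) (W : Submodule (ZMod 2) V) (v : V) :
    ZMod 2 :=
  if f v = 0 ∧ v ∈ perp f W ∧ v ∉ W then 1 else 0

open Classical in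
/-- The indicator function, with values in `𝔽₂`, of the complement of `perp f W`. -/
noncomputable def offPerpInd (f : QuadraticForm (ZMod 2) V) (W : Submodule (ZMod 2) V) (v : V) :
    ZMod 2 :=
  if v ∈ perp f W then 0 else 1

/-- The polar form of `f`, changed by `1` at the pairs consisting of a vector of type (ii) and a
vector off `perp f W`. On singular vectors it describes non-adjacency in the switched graph. -/
noncomputable def twistedPolar (f : QuadraticForm (ZMod 2) V) (W : Submodule (ZMod 2) V)
    (x y : V) : ZMod 2 :=
  polar f x y + typeTwoInd f W x * offPerpInd f W y + typeTwoInd f W y * offPerpInd f W x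

variable {f : QuadraticForm (ZMod 2) V} {W : Submodule (ZMod 2) V}

theorem typeTwoInd_eq_one {v : V} (h0 : f v = 0) (h1 : v ∈ perp f W) (h2 : v ∉ W) :
    typeTwoInd f W v = 1 := if_pos ⟨h0, h1, h2⟩

theorem typeTwoInd_of_mem {v : V} (h : v ∈ W) : typeTwoInd f W v = 0 :=
  if_neg fun h' => h'.2.2 h

theorem typeTwoInd_of_not_mem_perp {v : V} (h : v ∉ perp f W) : typeTwoInd f W v = 0 :=
  if_neg fun h' => h h'.2.1

theorem offPerpInd_of_mem {v : V} (h : v ∈ perp f W) : offPerpInd f W v = 0 := if_pos h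

theorem offPerpInd_of_not_mem {v : V} (h : v ∉ perp f W) : offPerpInd f W v = 1 := if_neg h

theorem typeTwoInd_mul_offPerpInd (v : V) : typeTwoInd f W v * offPerpInd f W v = 0 := by
  by_cases h : v ∈ perp f W
  · rw [offPerpInd_of_mem h, mul_zero]
  · rw [typeTwoInd_of_not_mem_perp h, zero_mul]

theorem twistedPolar_self {v : V} : twistedPolar f W v v = 0 := by
  rw [twistedPolar, typeTwoInd_mul_offPerpInd, polar_self, two_nsmul, CharTwo.add_self_eq_zero]
  simp

theorem map_add_eq_zero_iff_polar {v w : V} (hv : f v = 0) (hw : f w = 0) :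
    f (v + w) = 0 ↔ polar f v w = 0 := by
  simp [polar, hv, hw]

/-- As `W` is not orthogonal to `v`, the form takes both values on the coset `v + W`. -/
theorem exists_mem_singular_add (hW : ∀ w ∈ W, f w = 0) {v : V} (hv : v ∉ perp f W) :
    ∃ w ∈ W, f (v + w) = 0 := by
  obtain ⟨w, hw, h1⟩ := not_mem_perp.1 hv
  by_cases h0 : f v = 0
  · exact ⟨0, W.zero_mem, by rwa [add_zero]⟩
  · refine ⟨w, hw, ?_⟩
    rw [QuadraticMap.map_add f, h1, hW w hw, zmod_two_eq_one_of_ne_zero h0]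
    decide

theorem add_not_mem_perp (hW : ∀ w ∈ W, f w = 0) {v w : V} (hv : v ∉ perp f W) (hw : w ∈ W) :
    v + w ∉ perp f W :=
  fun h => hv (((perp f W).add_mem_iff_left (le_perp hW hw)).1 h)

theorem add_singular {v w : V} (hW : ∀ w ∈ W, f w = 0) (hv : f v = 0)
    (hp : v ∈ perp f W) (hw : w ∈ W) : f (v + w) = 0 :=
  (map_add_eq_zero_iff_polar hv (hW w hw)).2 (mem_perp.1 hp w hw)

theorem typeTwoInd_add (hW : ∀ w ∈ W, f w = 0) (v : V) {w : V} (hw : w ∈ W) :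
    typeTwoInd f W (v + w) = typeTwoInd f W v := by
  by_cases hp : v ∈ perp f W
  · have hp' : v + w ∈ perp f W := (perp f W).add_mem hp (le_perp hW hw)
    have hs : f (v + w) = f v := by
      rw [QuadraticMap.map_add f, mem_perp.1 hp w hw, hW w hw, add_zero, add_zero]
    by_cases h : f v = 0 ∧ v ∉ W
    · rw [typeTwoInd_eq_one h.1 hp h.2, typeTwoInd_eq_one (hs.trans h.1) hp'
        fun h' => h.2 ((W.add_mem_iff_left hw).1 h')]
    · rw [typeTwoInd, typeTwoInd,
        if_neg fun h' => h ⟨hs.symm.trans h'.1, fun hv => h'.2.2 (W.add_mem hv hw)⟩,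
        if_neg fun h' => h ⟨h'.1, h'.2.2⟩]
  · rw [typeTwoInd_of_not_mem_perp hp,
      typeTwoInd_of_not_mem_perp fun h => hp (((perp f W).add_mem_iff_left (le_perp hW hw)).1 h)]

/-- The vectors off a proper subspace span the whole space. -/
theorem polar_eq_zero_of_forall_off_perp (hne : perp f W ≠ ⊤) {p : V}
    (h : ∀ v, v ∉ perp f W → polar f p v = 0) (v : V) : polar f p v = 0 := by
  by_cases hv : v ∈ perp f W
  · obtain ⟨v₀, hv₀⟩ : ∃ v₀, v₀ ∉ perp f W := by
      by_contra! h'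
      exact hne (Submodule.eq_top_iff'.2 h')
    have h1 := h (v + v₀) fun h' => hv₀ (((perp f W).add_mem_iff_right hv).1 h')
    rwa [polar_add_right, h v₀ hv₀, add_zero] at h1
  · exact h v hv

/-- Since `perp f W` has codimension at least two, some line of the projective space misses it. -/
theorem exists_off_perp_triangle (hf : f.Nondegenerate) (hW : ∀ w ∈ W, f w = 0)
    (h2 : 2 ≤ finrank (ZMod 2) W) :
    ∃ v₁ v₂, v₁ ∉ perp f W ∧ v₂ ∉ perp f W ∧ v₁ + v₂ ∉ perp f W := by
  obtain ⟨e₁, he₁⟩ : ∃ e : W, e ≠ 0 := by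
    have : Nontrivial W := Module.nontrivial_of_finrank_pos (R := ZMod 2) (by omega)
    exact exists_ne 0
  obtain ⟨v₁, hv₁⟩ := exists_polar_eq_one hf (fun h => he₁ (Subtype.ext h)) (hW _ e₁.2)
  -- The functional `polar f v₁` has a nonzero zero on `W`, as `W` has dimension at least two.
  obtain ⟨e₂, he₂, he₂0, h12⟩ : ∃ e ∈ W, e ≠ 0 ∧ polar f v₁ e = 0 := by
    let φ : W →ₗ[ZMod 2] ZMod 2 := (f.polarBilin v₁).comp W.subtype
    have : FiniteDimensional (ZMod 2) W := Module.finite_of_finrank_pos (by omega)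
    have hk : 0 < finrank (ZMod 2) (LinearMap.ker φ) := by
      have h3 := LinearMap.finrank_range_add_finrank_ker φ
      have h4 := Submodule.finrank_le (LinearMap.range φ)
      rw [finrank_self] at h4
      omega
    have := Module.nontrivial_of_finrank_pos hk
    obtain ⟨e, he⟩ := exists_ne (0 : LinearMap.ker φ)
    exact ⟨e.1, e.1.2, fun h => he (Subtype.ext (Subtype.ext h)), e.2⟩
  obtain ⟨v₂, hv₂⟩ := exists_polar_eq_one hf he₂0 (hW _ he₂)
  rw [polar_comm] at hv₁ hv₂
  refine ⟨v₁, v₂, not_mem_perp.2 ⟨e₁, e₁.2, hv₁⟩, not_mem_perp.2 ⟨e₂, he₂, hv₂⟩,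
    not_mem_perp.2 ⟨e₂, he₂, ?_⟩⟩
  rw [polar_add_left, h12, hv₂, zero_add]

/-- For `W` of dimension at least two, the indicator functions of type (ii) and of the complement of
`perp f W` are linearly independent modulo the functionals `polar f p`, on singular vectors. -/
theorem parities_eq_zero (hf : f.Nondegenerate) (hW : ∀ w ∈ W, f w = 0)
    (h2 : 2 ≤ finrank (ZMod 2) W) {x₀ : V} (hx₀ : f x₀ = 0) (hx₀p : x₀ ∈ perp f W)
    (hx₀W : x₀ ∉ W) {p : V} {ε δ : ZMod 2}
    (h : ∀ u, f u = 0 → polar f p u + ε * offPerpInd f W u + δ * typeTwoInd f W u = 0) :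
    ε = 0 ∧ δ = 0 := by
  -- Both indicator functions vanish on `W`.
  have hp : ∀ w ∈ W, polar f p w = 0 := fun w hw => by
    simpa [offPerpInd_of_mem (le_perp hW hw), typeTwoInd_of_mem hw] using h w (hW w hw)
  have hoff : ∀ v, v ∉ perp f W → polar f p v = ε := fun v hv => by
    obtain ⟨w, hw, hs⟩ := exists_mem_singular_add hW hv
    have hn := add_not_mem_perp hW hv hw
    have := h _ hs
    rw [offPerpInd_of_not_mem hn, typeTwoInd_of_not_mem_perp hn, polar_add_right, hp w hw,
      add_zero, mul_one, mul_zero, add_zero] at this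
    exact CharTwo.add_eq_zero.1 this
  obtain ⟨v₁, v₂, h₁, h₂, h₁₂⟩ := exists_off_perp_triangle hf hW h2
  have hε : ε = 0 := by
    have := hoff _ h₁₂
    rw [polar_add_right, hoff _ h₁, hoff _ h₂, CharTwo.add_self_eq_zero] at this
    exact this.symm
  refine ⟨hε, ?_⟩
  have hall := polar_eq_zero_of_forall_off_perp (fun h' => h₁ (h' ▸ Submodule.mem_top))
    (fun v hv => (hoff v hv).trans hε)
  simpa [hε, hall x₀, typeTwoInd_eq_one hx₀ hx₀p hx₀W] using h x₀ hx₀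

/-- The rows of a vector of type (ii) and of a vector off `perp f W` add up to no third row of
`twistedPolar`. -/
theorem typeTwo_offPerp_no_third (hf : f.Nondegenerate) (hW : ∀ w ∈ W, f w = 0)
    (h2 : 2 ≤ finrank (ZMod 2) W) {x y : V} (hx : f x = 0) (hxp : x ∈ perp f W)
    (hxW : x ∉ W) (hy : y ∉ perp f W) (z : V) :
    ∃ u, f u = 0 ∧ twistedPolar f W x u + twistedPolar f W y u + twistedPolar f W z u ≠ 0 := by
  by_contra! h
  obtain ⟨h3, h4⟩ := parities_eq_zero hf hW h2 hx hxp hxW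
    (p := x + y + z) (ε := typeTwoInd f W x + typeTwoInd f W y + typeTwoInd f W z)
    (δ := offPerpInd f W x + offPerpInd f W y + offPerpInd f W z) fun u hu => by
      rw [← h u hu, polar_add_left, polar_add_left]
      simp only [twistedPolar]
      ring
  rw [typeTwoInd_eq_one hx hxp hxW, typeTwoInd_of_not_mem_perp hy, add_zero] at h3
  rw [offPerpInd_of_mem hxp, offPerpInd_of_not_mem hy, zero_add] at h4
  have h5 := typeTwoInd_mul_offPerpInd (f := f) (W := W) z
  -- By parity the third vector is both of type (ii) and off `perp f W`.
  rw [← CharTwo.add_eq_zero.1 h3, ← CharTwo.add_eq_zero.1 h4] at h5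
  exact absurd h5 (by decide)

/-! ### Neighbours for the twisted form -/

theorem exists_twisted_neighbor_of_typeTwo (hf : f.Nondegenerate) (hW : ∀ w ∈ W, f w = 0)
    (hne : perp f W ≠ ⊤) {x : V} (hx : f x = 0) (hxp : x ∈ perp f W)
    (hxW : x ∉ W) : ∃ y, f y = 0 ∧ y ∉ perp f W ∧ twistedPolar f W x y = 0 := by
  obtain ⟨v, hv, hxv⟩ : ∃ v, v ∉ perp f W ∧ polar f x v = 1 := by
    by_contra! h
    obtain ⟨u, hu⟩ := exists_polar_eq_one hf (by rintro rfl; exact hxW W.zero_mem) hx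
    rw [polar_eq_zero_of_forall_off_perp hne (fun v hv => by
      by_contra h'
      exact h v hv (zmod_two_eq_one_of_ne_zero h')) u] at hu
    exact absurd hu (by decide)
  obtain ⟨w, hw, hs⟩ := exists_mem_singular_add hW hv
  have hn := add_not_mem_perp hW hv hw
  refine ⟨v + w, hs, hn, ?_⟩
  rw [twistedPolar, polar_add_right, hxv, mem_perp.1 hxp w hw, typeTwoInd_eq_one hx hxp hxW,
    offPerpInd_of_not_mem hn, offPerpInd_of_mem hxp]
  simp only [mul_zero, add_zero, mul_one]
  decide

theorem exists_twisted_neighbor_of_off_perp (hW : ∀ w ∈ W, f w = 0) {x₀ : V} (hx₀ : f x₀ = 0)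
    (hx₀p : x₀ ∈ perp f W) (hx₀W : x₀ ∉ W) {y : V} (hy : y ∉ perp f W) :
    ∃ x, f x = 0 ∧ x ∈ perp f W ∧ x ∉ W ∧ twistedPolar f W y x = 0 := by
  obtain ⟨x, hx, hxp, hxW, h1⟩ :
      ∃ x, f x = 0 ∧ x ∈ perp f W ∧ x ∉ W ∧ polar f y x = 1 := by
    by_cases h : polar f y x₀ = 1
    · exact ⟨x₀, hx₀, hx₀p, hx₀W, h⟩
    · obtain ⟨w, hw, hyw⟩ := not_mem_perp.1 hy
      refine ⟨x₀ + w, add_singular hW hx₀ hx₀p hw, (perp f W).add_mem hx₀p (le_perp hW hw),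
        fun h' => hx₀W ((W.add_mem_iff_left hw).1 h'), ?_⟩
      have h0 : polar f y x₀ = 0 := by
        by_contra h'
        exact h (zmod_two_eq_one_of_ne_zero h')
      rw [polar_add_right, hyw, h0, zero_add]
  refine ⟨x, hx, hxp, hxW, ?_⟩
  rw [twistedPolar, h1, typeTwoInd_eq_one hx hxp hxW, typeTwoInd_of_not_mem_perp hy,
    offPerpInd_of_not_mem hy, zero_mul, add_zero, mul_one]
  decide

theorem twistedPolar_of_mem (hW : ∀ w ∈ W, f w = 0) {w : V} (hw : w ∈ W) (u : V) :
    twistedPolar f W w u = polar f w u := by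
  rw [twistedPolar, typeTwoInd_of_mem hw, offPerpInd_of_mem (le_perp hW hw)]
  simp

theorem twistedPolar_add_of_mem (hW : ∀ w ∈ W, f w = 0) {w : V} (hw : w ∈ W) (v u : V) :
    twistedPolar f W w u + twistedPolar f W v u + twistedPolar f W (w + v) u = 0 := by
  have h1 : offPerpInd f W (v + w) = offPerpInd f W v := by
    have h2 := (perp f W).add_mem_iff_left (x := v) (le_perp hW hw)
    unfold offPerpInd
    split_ifs <;> tauto
  rw [twistedPolar_of_mem hW hw, add_comm w v, twistedPolar, twistedPolar, h1,
    typeTwoInd_add hW v hw, polar_add_left]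
  linear_combination CharTwo.add_self_eq_zero
    (polar f w u + (polar f v u + typeTwoInd f W v * offPerpInd f W u +
      typeTwoInd f W u * offPerpInd f W v))

/-- If `W` is spanned by a single vector `e`, adding `e` to the vectors of type (ii) is an involution
`σ` with `twistedPolar f W x y = polar f (σ x) (σ y)`. The row of `x` plus the row of `y` is therefore the
row of `σ (σ x + σ y)`. -/
theorem exists_third_of_finrank_eq_one (hW : ∀ w ∈ W, f w = 0) (h1 : finrank (ZMod 2) W = 1)
    {x y : V} (hx : f x = 0) (hy : f y = 0) (hxy : x ≠ y) (hT : twistedPolar f W x y = 0) :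
    ∃ z, z ≠ 0 ∧ f z = 0 ∧
      ∀ u, twistedPolar f W x u + twistedPolar f W y u + twistedPolar f W z u = 0 := by
  obtain ⟨⟨e, he⟩, -, hspan⟩ := finrank_eq_one_iff'.1 h1
  have hoff : ∀ v, offPerpInd f W v = polar f v e := fun v => by
    by_cases hv : v ∈ perp f W
    · rw [offPerpInd_of_mem hv, mem_perp.1 hv e he]
    · rw [offPerpInd_of_not_mem hv]
      by_contra h0
      refine hv (mem_perp.2 fun w hw => ?_)
      obtain ⟨c, hc⟩ := hspan ⟨w, hw⟩
      have hc' : c • e = w := congrArg Subtype.val hc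
      have h0' : polar f v e = 0 := by
        by_contra h'
        exact h0 (zmod_two_eq_one_of_ne_zero h').symm
      rw [← hc', polar_smul_right, h0', smul_zero]
  let σ : V → V := fun v => v + typeTwoInd f W v • e
  have hmem : ∀ v, typeTwoInd f W v • e ∈ W := fun v => W.smul_mem _ he
  have hσσ : ∀ v, σ (σ v) = v := fun v => by
    change v + typeTwoInd f W v • e + typeTwoInd f W (v + typeTwoInd f W v • e) • e = v
    rw [typeTwoInd_add hW v (hmem v), add_assoc, ← add_smul, CharTwo.add_self_eq_zero, zero_smul,
      add_zero]
  have hσ0 : σ 0 = 0 := by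
    change 0 + typeTwoInd f W 0 • e = 0
    rw [typeTwoInd_of_mem W.zero_mem, zero_smul, add_zero]
  have hσf : ∀ v, f v = 0 → f (σ v) = 0 := fun v hv => by
    by_cases h : v ∈ perp f W
    · exact add_singular hW hv h (hmem v)
    · change f (v + typeTwoInd f W v • e) = 0
      rwa [typeTwoInd_of_not_mem_perp h, zero_smul, add_zero]
  have hσT : ∀ u v, twistedPolar f W u v = polar f (σ u) (σ v) := fun u v => by
    change _ = polar f (u + typeTwoInd f W u • e) (v + typeTwoInd f W v • e)
    simp only [polar_add_left, polar_add_right, polar_smul_left, polar_smul_right, smul_eq_mul,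
      polar_eq_zero_of_mem hW he he, twistedPolar, hoff, polar_comm f e v]
    ring
  refine ⟨σ (σ x + σ y), fun h => hxy ?_, hσf _ ?_, fun u => ?_⟩
  · have h' : σ x + σ y = 0 := by rw [← hσσ (σ x + σ y), h, hσ0]
    rw [← hσσ x, ← hσσ y, ← neg_eq_of_add_eq_zero_right h', ZModModule.neg_eq_self]
  · rw [map_add_eq_zero_iff_polar (hσf x hx) (hσf y hy), ← hσT, hT]
  · rw [hσT, hσT, hσT, hσσ, polar_add_left f (σ x), CharTwo.add_self_eq_zero]

end Vectors

/-! ### Third vertices in a graph -/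

section ThirdVertices

variable {A B : Type*}

open Classical in
/-- The `𝔽₂`-valued matrix of a graph with entry `1` at the pairs of distinct non-adjacent vertices. -/
noncomputable def nonAdj (G : SimpleGraph A) (x y : A) : ZMod 2 :=
  if x = y ∨ G.Adj x y then 0 else 1

/-- Each neighbour `y` of `x` admits a vertex `z` such that the rows of `x`, `y` and `z` in the
non-adjacency matrix sum to zero over `𝔽₂`. In the point-graph of a quadric of `PG(n, 2)` the third point
of the line through `x` and `y` is such a vertex `z`. -/
def HasThirdVertices (G : SimpleGraph A) (x : A) : Prop :=
  ∀ y, G.Adj x y → ∃ z, ∀ u, nonAdj G x u + nonAdj G y u + nonAdj G z u = 0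

theorem nonAdj_iso {G : SimpleGraph A} {H : SimpleGraph B} (φ : G ≃g H) (x y : A) :
    nonAdj H (φ x) (φ y) = nonAdj G x y := by
  have h : (φ x = φ y ∨ H.Adj (φ x) (φ y)) ↔ (x = y ∨ G.Adj x y) :=
    or_congr φ.injective.eq_iff φ.map_adj_iff
  unfold nonAdj
  split_ifs <;> tauto

theorem HasThirdVertices.map {G : SimpleGraph A} {H : SimpleGraph B} (φ : G ≃g H) {x : A}
    (h : HasThirdVertices G x) : HasThirdVertices H (φ x) := by
  intro y hy
  obtain ⟨y, rfl⟩ := φ.surjective y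
  obtain ⟨z, hz⟩ := h y (φ.map_adj_iff.1 hy)
  refine ⟨φ z, fun u => ?_⟩
  obtain ⟨u, rfl⟩ := φ.surjective u
  simpa only [nonAdj_iso] using hz u

end ThirdVertices

/-! ### Points of a quadric of `PG(n, 2)` as vectors -/

section Points

variable {n : ℕ} {f : QuadraticForm (ZMod 2) (Fin (n + 1) → ZMod 2)}

/-- Over `𝔽₂` a point has only one representative vector. -/
theorem rep_mk (v : Fin (n + 1) → ZMod 2) (hv : v ≠ 0) :
    (Projectivization.mk (ZMod 2) v hv).rep = v := by
  obtain ⟨a, ha⟩ := Projectivization.exists_smul_eq_mk_rep (ZMod 2) v hv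
  rw [← ha, Units.smul_def, zmod_two_eq_one_of_ne_zero a.ne_zero, one_smul]

theorem rep_injective : Function.Injective (fun P : PG (ZMod 2) n => P.rep) := fun P R h => by
  rw [← P.mk_rep, ← R.mk_rep]
  congr 1

theorem rep_mem_submodule {α : Projectivization.Subspace (ZMod 2) (Fin (n + 1) → ZMod 2)}
    {P : PG (ZMod 2) n} : P.rep ∈ α.submodule ↔ P ∈ α := by
  rw [Projectivization.Subspace.mem_submodule_iff _ P.rep_nonzero, P.mk_rep]

theorem exists_point {v : Fin (n + 1) → ZMod 2} (hv : v ≠ 0) (hf : f v = 0) :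
    ∃ P : quadric f, P.1.rep = v :=
  ⟨⟨_, (mk_mem_quadric_iff f v hv).2 hf⟩, rep_mk v hv⟩

theorem rep_ne {P R : quadric f} : P.1.rep ≠ R.1.rep ↔ P ≠ R :=
  (rep_injective.comp Subtype.val_injective).ne_iff

theorem subset_quadric_iff {α : Projectivization.Subspace (ZMod 2) (Fin (n + 1) → ZMod 2)} :
    (α : Set (PG (ZMod 2) n)) ⊆ quadric f ↔
      ∀ w ∈ α.submodule, f w = 0 := by
  refine ⟨fun h w hw => ?_, fun h P hP => h _ (rep_mem_submodule.2 hP)⟩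
  by_cases hw0 : w = 0
  · rw [hw0, QuadraticMap.map_zero]
  · rw [← mk_mem_quadric_iff f w hw0]
    exact h ((Projectivization.Subspace.mem_submodule_iff _ hw0).1 hw)

/-- The join of a totally singular subspace and a point of the quadric orthogonal to it lies on the
quadric. -/
theorem exists_singular_subspace {W : Submodule (ZMod 2) (Fin (n + 1) → ZMod 2)}
    (hW : ∀ w ∈ W, f w = 0) {P : quadric f} (hP : P.1.rep ∈ perp f W) (hPW : P.1.rep ∉ W) :
    ∃ S : Projectivization.Subspace (ZMod 2) (Fin (n + 1) → ZMod 2),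
      HasDim S (finrank (ZMod 2) W) ∧ (S : Set (PG (ZMod 2) n)) ⊆ quadric f ∧
      W ≤ S.submodule ∧ P.1 ∈ S := by
  refine ⟨Projectivization.Subspace.submodule.symm (W ⊔ Submodule.span (ZMod 2) {P.1.rep}),
    ?_, ?_, ?_, ?_⟩
  · rw [HasDim, OrderIso.apply_symm_apply, Submodule.finrank_sup_span_singleton hPW]
  · rw [subset_quadric_iff, OrderIso.apply_symm_apply]
    intro v hv
    obtain ⟨w, hw, u, hu, rfl⟩ := Submodule.mem_sup.1 hv
    obtain ⟨c, rfl⟩ := Submodule.mem_span_singleton.1 hu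
    have hPf : f P.1.rep = 0 := P.2
    rw [QuadraticMap.map_add f, hW w hw, QuadraticMap.map_smul, hPf, polar_smul_right, polar_comm,
      mem_perp.1 hP w hw]
    simp
  · rw [OrderIso.apply_symm_apply]
    exact le_sup_left
  · rw [← rep_mem_submodule, OrderIso.apply_symm_apply]
    exact Submodule.mem_sup_right (Submodule.mem_span_singleton_self _)

theorem pointGraph_adj {P R : quadric f} :
    (pointGraph (quadric f)).Adj P R ↔ P ≠ R ∧ polar f P.1.rep R.1.rep = 0 := by
  refine and_congr_right fun hne => ⟨?_, fun h => ?_⟩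
  · rintro ⟨ℓ, -, hℓ, hP, hR⟩
    exact polar_eq_zero_of_mem (subset_quadric_iff.1 hℓ) (rep_mem_submodule.2 hP)
      (rep_mem_submodule.2 hR)
  · have hPf : f P.1.rep = 0 := P.2
    obtain ⟨ℓ, h1, h2, h3, h4⟩ := exists_singular_subspace (P := R)
      (W := Submodule.span (ZMod 2) {P.1.rep})
      (fun w hw => by
        obtain ⟨c, rfl⟩ := Submodule.mem_span_singleton.1 hw
        rw [QuadraticMap.map_smul, hPf, smul_zero])
      (mem_perp.2 fun w hw => by
        obtain ⟨c, rfl⟩ := Submodule.mem_span_singleton.1 hw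
        rw [polar_smul_right, polar_comm, h, smul_zero])
      (fun hR => by
        obtain ⟨c, hc⟩ := Submodule.mem_span_singleton.1 hR
        have hc0 : c ≠ 0 := by
          rintro rfl
          exact R.1.rep_nonzero (by rw [← hc, zero_smul])
        rw [zmod_two_eq_one_of_ne_zero hc0, one_smul] at hc
        exact rep_ne.2 hne hc)
    rw [finrank_span_singleton P.1.rep_nonzero] at h1
    exact ⟨ℓ, h1, h2, rep_mem_submodule.1 (h3 (Submodule.mem_span_singleton_self _)), h4⟩

/-! ### Adjacency and third vertices in the switched graph -/

variable {s : ℕ} {α : Projectivization.Subspace (ZMod 2) (Fin (n + 1) → ZMod 2)}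

theorem mem_typeTwo (hα : HasDim α s) (hαf : (α : Set (PG (ZMod 2) n)) ⊆ quadric f)
    {P : quadric f} :
    P ∈ typeTwo (quadric f) s α ↔ P.1.rep ∈ perp f α.submodule ∧ P.1.rep ∉ α.submodule := by
  rw [rep_mem_submodule]
  constructor
  · rintro ⟨hP, S, -, hαS, hS, hPS⟩
    exact ⟨mem_perp.2 fun w hw => polar_eq_zero_of_mem (subset_quadric_iff.1 hS)
      (rep_mem_submodule.2 hPS) (Projectivization.Subspace.submodule.monotone hαS hw), hP⟩
  · rintro ⟨hP, hPα⟩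
    obtain ⟨S, h1, h2, h3, h4⟩ := exists_singular_subspace (subset_quadric_iff.1 hαf) hP
      (by rwa [rep_mem_submodule])
    rw [show finrank (ZMod 2) α.submodule = s + 1 from hα] at h1
    exact ⟨hPα, S, h1, Projectivization.Subspace.submodule.le_iff_le.1 h3, h2, h4⟩

/-- A point of `α` is joined to all points of type (ii). For a point `R` off `perp f W`, translation by a
vector of `W` not orthogonal to `R` exchanges the neighbours and the non-neighbours of `R` of type (ii). -/
theorem isHalfJoined_iff (hα : HasDim α s) (hαf : (α : Set (PG (ZMod 2) n)) ⊆ quadric f)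
    (hX : (typeTwo (quadric f) s α).Nonempty) {R : quadric f} :
    IsHalfJoined (pointGraph (quadric f)) (typeTwo (quadric f) s α) R ↔
      R.1.rep ∉ perp f α.submodule := by
  have hW := subset_quadric_iff.1 hαf
  have hmem := fun P : quadric f => mem_typeTwo hα hαf (P := P)
  set X := typeTwo (quadric f) s α
  set N := (pointGraph (quadric f)).neighborSet R
  constructor
  · rintro ⟨hRX, hcard⟩ hR
    have hRW : R.1.rep ∈ α.submodule := by
      by_contra h
      exact hRX ((hmem R).2 ⟨hR, h⟩)
    have hsub : N ∩ X = X := Set.inter_eq_right.2 fun P hP => by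
      refine pointGraph_adj.2 ⟨fun h => hRX (h ▸ hP), ?_⟩
      rw [polar_comm]
      exact mem_perp.1 ((hmem P).1 hP).1 _ hRW
    rw [hsub] at hcard
    have := (Set.ncard_pos X.toFinite).2 hX
    omega
  · intro hR
    have hRX : R ∉ X := fun h => hR ((hmem R).1 h).1
    refine ⟨hRX, ?_⟩
    obtain ⟨w, hw, hRw⟩ := not_mem_perp.1 hR
    -- Translation by `w` is an involution `τ` of the set of points of type (ii).
    have hshift : ∀ P ∈ X, ∃ P' ∈ X, P'.1.rep = P.1.rep + w := fun P hP => by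
      obtain ⟨h1, h2⟩ := (hmem P).1 hP
      have h3 : P.1.rep + w ∉ α.submodule := fun h => h2 ((Submodule.add_mem_iff_left _ hw).1 h)
      obtain ⟨P', hP'⟩ := exists_point (f := f) (v := P.1.rep + w)
        (fun h => h3 (h ▸ Submodule.zero_mem _)) (add_singular hW P.2 h1 hw)
      refine ⟨P', (hmem P').2 ?_, hP'⟩
      rw [hP']
      exact ⟨Submodule.add_mem _ h1 (le_perp hW hw), h3⟩
    choose! τ hτX hτ using hshift
    have hadj : ∀ P ∈ X, (P ∈ N ↔ polar f R.1.rep P.1.rep = 0) := fun P hP =>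
      pointGraph_adj.trans (and_iff_right fun h => hRX (h ▸ hP))
    have hpol : ∀ P ∈ X, polar f R.1.rep (τ P).1.rep = polar f R.1.rep P.1.rep + 1 :=
      fun P hP => by rw [hτ P hP, polar_add_right, hRw]
    have hττ : ∀ P ∈ X, τ (τ P) = P := fun P hP => by
      by_contra h
      refine rep_ne.2 h ?_
      rw [hτ _ (hτX P hP), hτ P hP, add_assoc, ZModModule.add_self, add_zero]
    have heq : (N ∩ X).ncard = (X \ N).ncard := by
      refine Set.ncard_congr (fun P _ => τ P) ?_ ?_ ?_
      · rintro P ⟨hPN, hPX⟩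
        refine ⟨hτX P hPX, fun h => ?_⟩
        rw [hadj _ (hτX P hPX), hpol P hPX, (hadj P hPX).1 hPN] at h
        exact absurd h (by decide)
      · rintro P P' ⟨-, hP⟩ ⟨-, hP'⟩ h
        rw [← hττ P hP, h, hττ P' hP']
      · rintro P ⟨hPX, hPN⟩
        refine ⟨τ P, ⟨?_, hτX P hPX⟩, hττ P hPX⟩
        rw [hadj _ (hτX P hPX), hpol P hPX, zmod_two_eq_one_of_ne_zero fun h => hPN ((hadj P hPX).2 h)]
        decide
    have := Set.ncard_inter_add_ncard_sdiff_eq_ncard X N X.toFinite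
    rw [Set.inter_comm] at this
    change 2 * (N ∩ X).ncard = X.ncard
    omega

/-- Switching as a bilinear correction: here `a` is non-adjacency before the switching, `t`, `t'` tell
whether the two vertices are in the switching set, and `o`, `o'` whether they are half-joined to it. -/
theorem xor_toggle_iff {a t o t' o' : ZMod 2} (h : t * o = 0) (h' : t' * o' = 0) :
    Xor (a = 0) ((o = 1 ∧ t' = 1) ∨ (o' = 1 ∧ t = 1)) ↔ a + t * o' + t' * o = 0 := by
  revert a t o t' o'
  unfold Xor
  set_option synthInstance.maxSize 2000 in
  decide

theorem nonAdj_graphGamma (hα : HasDim α s) (hαf : (α : Set (PG (ZMod 2) n)) ⊆ quadric f)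
    (hX : (typeTwo (quadric f) s α).Nonempty) (P R : quadric f) :
    nonAdj (graphGamma (quadric f) s α) P R = twistedPolar f α.submodule P.1.rep R.1.rep := by
  have hT : ∀ P : quadric f, P ∈ typeTwo (quadric f) s α ↔ typeTwoInd f α.submodule P.1.rep = 1 :=
    fun P => by
      have hPf : f P.1.rep = 0 := P.2
      rw [mem_typeTwo hα hαf, typeTwoInd]
      simp [hPf]
  have hO : ∀ P : quadric f, IsHalfJoined (pointGraph (quadric f)) (typeTwo (quadric f) s α) P ↔
      offPerpInd f α.submodule P.1.rep = 1 := fun P => by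
    rw [isHalfJoined_iff hα hαf hX, offPerpInd]
    simp
  rcases eq_or_ne P R with rfl | hne
  · rw [twistedPolar_self, nonAdj, if_pos (Or.inl rfl)]
  · have hadj : (P = R ∨ (graphGamma (quadric f) s α).Adj P R) ↔
        twistedPolar f α.submodule P.1.rep R.1.rep = 0 := by
      rw [or_iff_right hne, twistedPolar,
        ← xor_toggle_iff (typeTwoInd_mul_offPerpInd _) (typeTwoInd_mul_offPerpInd _),
        ← hT, ← hT, ← hO, ← hO, ← and_iff_right hne (b := polar f P.1.rep R.1.rep = 0),
        ← pointGraph_adj]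
      rfl
    by_cases h : twistedPolar f α.submodule P.1.rep R.1.rep = 0
    · rw [nonAdj, if_pos (hadj.2 h), h]
    · rw [nonAdj, if_neg (mt hadj.1 h), zmod_two_eq_one_of_ne_zero h]

theorem graphGamma_adj (hα : HasDim α s) (hαf : (α : Set (PG (ZMod 2) n)) ⊆ quadric f)
    (hX : (typeTwo (quadric f) s α).Nonempty) {P R : quadric f} :
    (graphGamma (quadric f) s α).Adj P R ↔
      P ≠ R ∧ twistedPolar f α.submodule P.1.rep R.1.rep = 0 := by
  rw [← nonAdj_graphGamma hα hαf hX, nonAdj]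
  constructor
  · exact fun h => ⟨h.ne, if_pos (Or.inr h)⟩
  · rintro ⟨hne, h⟩
    by_contra h'
    rw [if_neg (not_or.2 ⟨hne, h'⟩)] at h
    exact absurd h (by decide)

theorem hasThirdVertices_of_mem (hα : HasDim α s)
    (hαf : (α : Set (PG (ZMod 2) n)) ⊆ quadric f) (hX : (typeTwo (quadric f) s α).Nonempty)
    {P : quadric f} (hP : P.1 ∈ α) : HasThirdVertices (graphGamma (quadric f) s α) P := by
  intro R hPR
  have hW := subset_quadric_iff.1 hαf
  have hPW := rep_mem_submodule.2 hP
  obtain ⟨hne, h0⟩ := (graphGamma_adj hα hαf hX).1 hPR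
  rw [twistedPolar_of_mem hW hPW] at h0
  obtain ⟨S, hS⟩ := exists_point (f := f) (v := P.1.rep + R.1.rep)
    (fun h => rep_ne.2 hne (by rw [← neg_eq_of_add_eq_zero_right h, ZModModule.neg_eq_self]))
    ((map_add_eq_zero_iff_polar P.2 R.2).2 h0)
  refine ⟨S, fun u => ?_⟩
  simp only [nonAdj_graphGamma hα hαf hX, hS]
  exact twistedPolar_add_of_mem hW hPW _ _

theorem hasThirdVertices_of_point (hα : HasDim α 0)
    (hαf : (α : Set (PG (ZMod 2) n)) ⊆ quadric f) (hX : (typeTwo (quadric f) 0 α).Nonempty)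
    (P : quadric f) : HasThirdVertices (graphGamma (quadric f) 0 α) P := by
  intro R hPR
  obtain ⟨hne, h0⟩ := (graphGamma_adj hα hαf hX).1 hPR
  obtain ⟨z, hz0, hz, hu⟩ := exists_third_of_finrank_eq_one (subset_quadric_iff.1 hαf) hα P.2 R.2
    (rep_ne.2 hne) h0
  obtain ⟨S, rfl⟩ := exists_point hz0 hz
  refine ⟨S, fun u => ?_⟩
  simp only [nonAdj_graphGamma hα hαf hX]
  exact hu _

/-- For a point off `α` the defining property fails at a neighbour of the other class: at one off
`perp f W` if the point is of type (ii), and at one of type (ii) if it is off `perp f W`. -/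
theorem mem_of_hasThirdVertices (hf : f.Nondegenerate) (hs : 1 ≤ s) (hα : HasDim α s)
    (hαf : (α : Set (PG (ZMod 2) n)) ⊆ quadric f) (hX : (typeTwo (quadric f) s α).Nonempty)
    {P : quadric f} (hP : HasThirdVertices (graphGamma (quadric f) s α) P) : P.1 ∈ α := by
  have hW := subset_quadric_iff.1 hαf
  have h2 : 2 ≤ finrank (ZMod 2) α.submodule := by
    rw [show finrank (ZMod 2) α.submodule = s + 1 from hα]
    omega
  have hno : ∀ T R S : quadric f, T.1.rep ∈ perp f α.submodule → T.1.rep ∉ α.submodule →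
      R.1.rep ∉ perp f α.submodule →
      ¬ ∀ U, nonAdj (graphGamma (quadric f) s α) T U + nonAdj (graphGamma (quadric f) s α) R U +
        nonAdj (graphGamma (quadric f) s α) S U = 0 := by
    intro T R S hTp hTW hR h
    obtain ⟨u, hu, hne⟩ := typeTwo_offPerp_no_third hf hW h2 T.2 hTp hTW hR S.1.rep
    have hu0 : u ≠ 0 := by
      rintro rfl
      refine hne ?_
      rw [twistedPolar, twistedPolar, twistedPolar, typeTwoInd_of_mem (Submodule.zero_mem _),
        offPerpInd_of_mem (Submodule.zero_mem _)]
      simp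
    obtain ⟨U, rfl⟩ := exists_point hu0 hu
    refine hne ?_
    simpa only [nonAdj_graphGamma hα hαf hX] using h U
  obtain ⟨X₀, hX₀⟩ := hX
  obtain ⟨hX₀p, hX₀W⟩ := (mem_typeTwo hα hαf).1 hX₀
  have hX : (typeTwo (quadric f) s α).Nonempty := ⟨X₀, hX₀⟩
  by_contra hPα
  rw [← rep_mem_submodule] at hPα
  by_cases hPp : P.1.rep ∈ perp f α.submodule
  · obtain ⟨v₁, -, hv₁, -⟩ := exists_off_perp_triangle hf hW h2
    obtain ⟨y, hy, hyp, h0⟩ := exists_twisted_neighbor_of_typeTwo hf hW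
      (fun h' => hv₁ (h' ▸ Submodule.mem_top)) P.2 hPp hPα
    obtain ⟨R, rfl⟩ := exists_point (f := f) (v := y)
      (by rintro rfl; exact hyp (Submodule.zero_mem _)) hy
    obtain ⟨S, hS⟩ := hP R ((graphGamma_adj hα hαf hX).2
      ⟨fun h => hyp (h ▸ hPp), h0⟩)
    exact hno P R S hPp hPα hyp hS
  · obtain ⟨x, hx, hxp, hxW, h0⟩ :=
      exists_twisted_neighbor_of_off_perp hW X₀.2 hX₀p hX₀W hPp
    obtain ⟨R, rfl⟩ := exists_point (f := f) (v := x)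
      (by rintro rfl; exact hxW (Submodule.zero_mem _)) hx
    obtain ⟨S, hS⟩ := hP R ((graphGamma_adj hα hαf hX).2
      ⟨fun h => hPp (h ▸ hxp), h0⟩)
    refine hno R P S hxp hxW hPp fun U => ?_
    rw [← hS U]
    ring

theorem typeTwo_nonempty {g : ℕ} (hg : IsProjectiveIndex (quadric f) g) (hs : s < g)
    (hα : HasDim α s) (hαf : (α : Set (PG (ZMod 2) n)) ⊆ quadric f) :
    (typeTwo (quadric f) s α).Nonempty := by
  obtain ⟨T, hT, hTf⟩ := hg.1
  obtain ⟨u, hu, hup, huW⟩ := exists_singular_perp_not_mem (W := α.submodule)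
    (subset_quadric_iff.1 hTf) (by
      rw [show finrank (ZMod 2) α.submodule = s + 1 from hα,
        show finrank (ZMod 2) T.submodule = g + 1 from hT]
      omega)
  obtain ⟨P, rfl⟩ := exists_point (f := f) (v := u)
    (by rintro rfl; exact huW (Submodule.zero_mem _)) hu
  exact ⟨P, (mem_typeTwo hα hαf).2 ⟨mem_perp.2 hup, huW⟩⟩

theorem ncard_points (hα : HasDim α s) (hαf : (α : Set (PG (ZMod 2) n)) ⊆ quadric f) :
    {P : quadric f | P.1 ∈ α}.ncard + 1 = 2 ^ (s + 1) := by
  have hW := subset_quadric_iff.1 hαf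
  have himg : (fun P : quadric f => P.1.rep) '' {P | P.1 ∈ α} = (α.submodule : Set _) \ {0} := by
    ext v
    constructor
    · rintro ⟨P, hP, rfl⟩
      exact ⟨rep_mem_submodule.2 hP, P.1.rep_nonzero⟩
    · rintro ⟨hv, hv0⟩
      obtain ⟨P, rfl⟩ := exists_point hv0 (hW v hv)
      exact ⟨P, rep_mem_submodule.1 hv, rfl⟩
  rw [← Set.ncard_image_of_injective _ (rep_injective.comp Subtype.val_injective)]
  change ((fun P : quadric f => P.1.rep) '' {P | P.1 ∈ α}).ncard + 1 = _
  rw [himg, Set.ncard_sdiff_singleton_add_one (Submodule.zero_mem _) (Set.toFinite _),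
    ← Nat.card_coe_set_eq]
  change Nat.card α.submodule = _
  rw [Module.natCard_eq_pow_finrank (K := ZMod 2), Nat.card_zmod,
    show finrank (ZMod 2) α.submodule = s + 1 from hα]

theorem isEmpty_graphGamma_iso_of_lt {g t : ℕ} (hf : f.Nondegenerate)
    (hg : IsProjectiveIndex (quadric f) g) (hst : s < t) (ht : t < g)
    {β : Projectivization.Subspace (ZMod 2) (Fin (n + 1) → ZMod 2)}
    (hα : HasDim α s) (hαf : (α : Set (PG (ZMod 2) n)) ⊆ quadric f)
    (hβ : HasDim β t) (hβf : (β : Set (PG (ZMod 2) n)) ⊆ quadric f) :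
    IsEmpty (graphGamma (quadric f) s α ≃g graphGamma (quadric f) t β) := by
  have hX := typeTwo_nonempty hg (hst.trans ht) hα hαf
  have hY := typeTwo_nonempty hg ht hβ hβf
  refine ⟨fun φ => ?_⟩
  have hβmem := fun (P : quadric f) =>
    mem_of_hasThirdVertices (P := P) hf (by omega) hβ hβf hY
  rcases Nat.eq_zero_or_pos s with rfl | hs
  · obtain ⟨R, hR⟩ := hY
    refine hR.1 (hβmem R ?_)
    simpa using (hasThirdVertices_of_point hα hαf hX (φ.symm R)).map φ
  · have heq : φ '' {P | P.1 ∈ α} = {P | P.1 ∈ β} := by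
      ext R
      constructor
      · rintro ⟨P, hP, rfl⟩
        exact hβmem _ ((hasThirdVertices_of_mem hα hαf hX hP).map φ)
      · intro hR
        refine ⟨φ.symm R, mem_of_hasThirdVertices hf hs hα hαf hX
          ((hasThirdVertices_of_mem hβ hβf hY hR).map φ.symm), φ.apply_symm_apply R⟩
    have h1 := ncard_points hα hαf
    have h2 := ncard_points hβ hβf
    rw [← heq, Set.ncard_image_of_injective _ φ.injective, h1] at h2
    have := Nat.pow_right_injective le_rfl h2
    omega

end Points

end PG

theorem theorem5p2 (n g : ℕ) (𝒬 : Set (PG (ZMod 2) n)) (h𝒬 : PG.IsNonsingularQuadric 𝒬)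
    (hg : PG.IsProjectiveIndex 𝒬 g) (hg1 : 1 ≤ g)
    (s t : ℕ) (hs : s < g) (ht : t < g) (hst : s ≠ t)
    (α β : Projectivization.Subspace (ZMod 2) (Fin (n + 1) → ZMod 2))
    (hα : PG.HasDim α s) (hα𝒬 : (α : Set (PG (ZMod 2) n)) ⊆ 𝒬)
    (hβ : PG.HasDim β t) (hβ𝒬 : (β : Set (PG (ZMod 2) n)) ⊆ 𝒬) :
    IsEmpty (PG.graphGamma 𝒬 s α ≃g PG.graphGamma 𝒬 t β) := by
  obtain ⟨f, hf, rfl⟩ := h𝒬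
  rcases hst.lt_or_gt with h | h
  · exact PG.isEmpty_graphGamma_iso_of_lt hf hg h ht hα hα𝒬 hβ hβ𝒬
  · have := PG.isEmpty_graphGamma_iso_of_lt hf hg h hs hβ hβ𝒬 hα hα𝒬
    exact ⟨fun φ => this.false φ.symm⟩
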